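/- Let $0<\alpha\le 1$. The initial value problem $$F'(x)=1-F(x)^{\alpha}\quad (x\ge 0),\qquad F(0)=0$$ (with one-sided derivative at $x=0$) has a solution $F:[0,+\infty)\to\mathbb{R}$, and for every such solution $F=F_\alpha$ the function $\widetilde F_\alpha(x)=1-F_\alpha(x)$ satisfies $$\widetilde F_\alpha(x)\,\widetilde F_\alpha(y)\le \widetilde F_\alpha(x+y)\qquad\text{for all } x,y\ge 0.$$ -/

import Mathlib

/-- `F` is a solution on the half-line `[0, ∞)` of the initial value problem
`F'(x) = 1 - F(x) ^ α`, `F(0) = 0` (the derivative at `0` is the one-sided one).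
For `α > 0` such an `F` is automatically nonnegative on `[0, ∞)`: `F' = 1` wherever `F` vanishes,
so `F` cannot cross zero downwards. Hence only real powers of nonnegative numbers occur. -/
structure IsProfileFunction (α : ℝ) (F : ℝ → ℝ) : Prop where
  map_zero : F 0 = 0
  hasDerivWithinAt : ∀ x : ℝ, 0 ≤ x → HasDerivWithinAt F (1 - F x ^ α) (Set.Ici 0) x

/-!
Put `w = -log (1 - F)`. If `F` solves `F' = g (F)`, then `w` solves `w' = k (w)` with
`k = g (u) / (1 - u)` at `u = 1 - exp (-w)`. For convex `g` with `g 1 = 0`, minus `k` is the slope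
of the secant of `g` through the endpoint `1`, so `k` is antitone in `w`. As `w` increases, `w'`
decreases, so `w` is concave; since `w 0 = 0`, it is subadditive, and exponentiating gives the
inequality. The same substitution gives existence: `k` is positive and bounded, so separation of
variables produces a global `w`. (For `α < 1` the original right-hand side `1 - u ^ α` is not
Lipschitz at `u = 0`, so the Picard–Lindelöf theorem does not apply.)
-/

open Set Filter Real

section Subadditivity

theorem map_add_le_of_concaveOn_Ici {𝕜 : Type*} [Field 𝕜] [LinearOrder 𝕜] [IsStrictOrderedRing 𝕜]
    {f : 𝕜 → 𝕜} (hf : ConcaveOn 𝕜 (Ici 0) f) (hf₀ : 0 ≤ f 0) {x y : 𝕜} (hx : 0 ≤ x)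
    (hy : 0 ≤ y) : f (x + y) ≤ f x + f y := by
  rcases (add_nonneg hx hy).eq_or_lt with hxy | hxy
  · obtain ⟨rfl, rfl⟩ := (add_eq_zero_iff_of_nonneg hx hy).1 hxy.symm
    simpa only [add_zero] using le_add_of_nonneg_left hf₀
  have chord {s t : 𝕜} (hs : 0 ≤ s) (ht : 0 ≤ t) (hst : s + t = x + y) :
      s / (x + y) * f (x + y) ≤ f s := by
    have h := hf.2 (mem_Ici.2 hxy.le) self_mem_Ici (div_nonneg hs hxy.le) (div_nonneg ht hxy.le)
      (by rw [← add_div, hst, div_self hxy.ne'])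
    simp only [smul_eq_mul, mul_zero, add_zero, div_mul_cancel₀ _ hxy.ne'] at h
    exact (le_add_of_nonneg_right (mul_nonneg (div_nonneg ht hxy.le) hf₀)).trans h
  calc f (x + y) = x / (x + y) * f (x + y) + y / (x + y) * f (x + y) := by
        rw [← add_mul, ← add_div, div_self hxy.ne', one_mul]
    _ ≤ f x + f y := add_le_add (chord hx hy rfl) (chord hy hx (add_comm y x))

theorem concaveOn_of_isIntegralCurveOn_antitoneOn {w k : ℝ → ℝ} {D E : Set ℝ} (hD : Convex ℝ D)
    (hw : IsIntegralCurveOn w (fun _ => k) D) (hwE : MapsTo w D E) (hk : AntitoneOn k E)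
    (hk₀ : ∀ v ∈ E, 0 ≤ k v) : ConcaveOn ℝ D w := by
  have hderiv {x : ℝ} (hx : x ∈ interior D) : HasDerivAt w (k (w x)) x :=
    (hw x (interior_subset hx)).hasDerivAt (mem_interior_iff_mem_nhds.1 hx)
  have hmono : MonotoneOn w D :=
    monotoneOn_of_hasDerivWithinAt_nonneg hD hw.continuousOn
      (fun x hx => (hderiv hx).hasDerivWithinAt) fun x hx => hk₀ _ (hwE (interior_subset hx))
  refine AntitoneOn.concaveOn_of_deriv hD hw.continuousOn
    (fun x hx => (hderiv hx).differentiableAt.differentiableWithinAt) fun x hx y hy hxy => ?_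
  rw [(hderiv hx).deriv, (hderiv hy).deriv]
  have hx' := interior_subset hx
  have hy' := interior_subset hy
  exact hk (hwE hx') (hwE hy') (hmono hx' hy' hxy)

end Subadditivity

section SeparationOfVariables

theorem surjective_of_le_hasDerivAt {f f' : ℝ → ℝ} {c : ℝ} (hc : 0 < c)
    (hf : ∀ x, HasDerivAt f (f' x) x) (hf' : ∀ x, c ≤ f' x) : Function.Surjective f := by
  have hdiff : Differentiable ℝ f := fun x => (hf x).differentiableAt
  have hgrowth : ∀ ⦃x y⦄, x ≤ y → c * (y - x) ≤ f y - f x :=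
    mul_sub_le_image_sub_of_le_deriv hdiff fun x => (hf x).deriv.symm ▸ hf' x
  refine hdiff.continuous.surjective ?_ ?_
  · refine tendsto_atTop_mono' (f₁ := fun x => c * x + f 0) _ ?_
      (tendsto_atTop_add_const_right _ _ (tendsto_id.const_mul_atTop hc))
    filter_upwards [eventually_ge_atTop 0] with x hx
    linarith [hgrowth hx]
  · refine tendsto_atBot_mono' (f₁ := fun x => c * x + f 0) _ ?_
      (tendsto_atBot_add_const_right _ _ (tendsto_id.const_mul_atBot hc))
    filter_upwards [eventually_le_atBot 0] with x hx
    linarith [hgrowth hx]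

theorem exists_isIntegralCurve_of_pos_of_le {k : ℝ → ℝ} {C : ℝ} (hk : Continuous k)
    (hpos : ∀ v, 0 < k v) (hle : ∀ v, k v ≤ C) (w₀ : ℝ) :
    ∃ w : ℝ → ℝ, w 0 = w₀ ∧ IsIntegralCurve w (fun _ => k) := by
  let S : ℝ → ℝ := fun v => ∫ t in w₀..v, (k t)⁻¹
  have hS (v : ℝ) : HasDerivAt S (k v)⁻¹ v :=
    ((hk.inv₀ fun v => (hpos v).ne').integral_hasStrictDerivAt w₀ v).hasDerivAt
  have hmono : StrictMono S := strictMono_of_hasDerivAt_pos hS fun v => inv_pos.2 (hpos v)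
  have hsurj : Function.Surjective S :=
    surjective_of_le_hasDerivAt (inv_pos.2 ((hpos 0).trans_le (hle 0))) hS
      fun v => inv_anti₀ (hpos v) (hle v)
  let e : ℝ ≃o ℝ := hmono.orderIsoOfSurjective S hsurj
  refine ⟨e.symm, ?_, fun x => ?_⟩
  · exact e.symm_apply_eq.2 (intervalIntegral.integral_same (f := fun t => (k t)⁻¹)).symm
  · have h := (hS (e.symm x)).of_local_left_inverse e.symm.continuous.continuousAt
      (inv_pos.2 (hpos _)).ne' (Eventually.of_forall e.apply_symm_apply)
    rwa [inv_inv] at h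

end SeparationOfVariables

section LogarithmicSubstitution

variable {g F w : ℝ → ℝ} {C : ℝ} {s : Set ℝ}

/-- The vector field `k` that `F' = g (F)` becomes in the coordinate `w = -log (1 - F)`, in which
the equation reads `w' = k (w)`. -/
noncomputable def logField (g : ℝ → ℝ) (v : ℝ) : ℝ :=
  exp v * g (1 - exp (-v))

theorem logField_eq_div (g : ℝ → ℝ) (v : ℝ) :
    logField g v = g (1 - exp (-v)) / (1 - (1 - exp (-v))) := by
  rw [logField, sub_sub_cancel, exp_neg, div_inv_eq_mul, mul_comm]

theorem one_sub_exp_neg_mem_Ico {v : ℝ} (hv : 0 ≤ v) : 1 - exp (-v) ∈ Ico (0 : ℝ) 1 :=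
  ⟨sub_nonneg.2 (exp_le_one_iff.2 (neg_nonpos.2 hv)), sub_lt_self _ (exp_pos _)⟩

theorem logField_pos (hpos : ∀ u ∈ Ico (0 : ℝ) 1, 0 < g u) {v : ℝ} (hv : 0 ≤ v) :
    0 < logField g v :=
  mul_pos (exp_pos v) (hpos _ (one_sub_exp_neg_mem_Ico hv))

theorem logField_le (hle : ∀ u ∈ Ico (0 : ℝ) 1, g u ≤ C * (1 - u)) {v : ℝ} (hv : 0 ≤ v) :
    logField g v ≤ C := by
  have hu := one_sub_exp_neg_mem_Ico hv
  rw [logField_eq_div, div_le_iff₀ (sub_pos.2 hu.2)]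
  exact hle _ hu

theorem antitoneOn_logField (hg : ConvexOn ℝ (Icc 0 1) g) (hg₁ : g 1 = 0) :
    AntitoneOn (logField g) (Ici 0) := by
  intro v hv v' hv' hvv'
  have hu := one_sub_exp_neg_mem_Ico hv
  have hu' := one_sub_exp_neg_mem_Ico hv'
  have hsecant := hg.secant_mono (right_mem_Icc.2 zero_le_one) (Ico_subset_Icc_self hu)
    (Ico_subset_Icc_self hu') hu.2.ne hu'.2.ne
    (sub_le_sub_left (exp_le_exp.2 (neg_le_neg hvv')) 1)
  rw [hg₁, sub_zero, sub_zero, ← neg_sub 1, ← neg_sub 1, div_neg, div_neg, neg_le_neg_iff]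
    at hsecant
  simpa only [logField_eq_div] using hsecant

theorem isIntegralCurveOn_neg_log_one_sub (hF : IsIntegralCurveOn F (fun _ => g) s)
    (hF₁ : ∀ x ∈ s, F x < 1) :
    IsIntegralCurveOn (fun x => -log (1 - F x)) (fun _ => logField g) s := by
  intro x hx
  have hpos : 0 < 1 - F x := sub_pos.2 (hF₁ x hx)
  refine (((hF x hx).const_sub 1).log hpos.ne').neg.congr_deriv ?_
  simp only [logField_eq_div, neg_neg, exp_log hpos, sub_sub_cancel, neg_div]

theorem isIntegralCurveOn_one_sub_exp_neg (hw : IsIntegralCurveOn w (fun _ => logField g) s) :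
    IsIntegralCurveOn (fun x => 1 - exp (-w x)) (fun _ => g) s := by
  intro x hx
  refine ((hw x hx).neg.exp.const_sub 1).congr_deriv ?_
  simp only [logField, Pi.neg_apply, mul_neg, neg_neg, ← mul_assoc, ← exp_add, neg_add_cancel,
    exp_zero, one_mul]

theorem exists_isIntegralCurveOn_Ici_zero (hcont : ContinuousOn g (Ico 0 1))
    (hpos : ∀ u ∈ Ico (0 : ℝ) 1, 0 < g u) (hle : ∀ u ∈ Ico (0 : ℝ) 1, g u ≤ C * (1 - u)) :
    ∃ F : ℝ → ℝ, F 0 = 0 ∧ IsIntegralCurveOn F (fun _ => g) (Ici 0) := by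
  have hk : Continuous fun v => logField g (max 0 v) :=
    (continuous_exp.comp (by fun_prop)).mul <|
      hcont.comp_continuous (by fun_prop) fun v => one_sub_exp_neg_mem_Ico (le_max_left 0 v)
  obtain ⟨w, hw₀, hw⟩ := exists_isIntegralCurve_of_pos_of_le hk
    (fun v => logField_pos hpos (le_max_left 0 v)) (fun v => logField_le hle (le_max_left 0 v)) 0
  have hmono : Monotone w :=
    monotone_of_hasDerivAt_nonneg hw fun x => (logField_pos hpos (le_max_left 0 (w x))).le
  have hwOn : IsIntegralCurveOn w (fun _ => logField g) (Ici 0) := by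
    intro x hx
    have hwx : 0 ≤ w x := hw₀ ▸ hmono hx
    simpa only [max_eq_right hwx] using (hw x).hasDerivWithinAt (s := Ici 0)
  exact ⟨fun x => 1 - exp (-w x), by simp [hw₀], isIntegralCurveOn_one_sub_exp_neg hwOn⟩

end LogarithmicSubstitution

section Barriers

variable {g F : ℝ → ℝ}

theorem hasDerivWithinAt_Ici_of_isIntegralCurveOn {t₀ x : ℝ}
    (hF : IsIntegralCurveOn F (fun _ => g) (Ici t₀)) (hx : t₀ ≤ x) :
    HasDerivWithinAt F (g (F x)) (Ici x) x :=
  (hF x hx).mono (Ici_subset_Ici.2 hx)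

theorem le_of_isIntegralCurveOn_Ici {a t₀ x : ℝ}
    (hF : IsIntegralCurveOn F (fun _ => g) (Ici t₀)) (ha : a ≤ F t₀) (hga : 0 < g a)
    (hx : t₀ ≤ x) : a ≤ F x :=
  image_le_of_deriv_right_lt_deriv_boundary' (f := fun _ => a) (f' := fun _ => 0)
    continuousOn_const (fun _ _ => hasDerivWithinAt_const ..) ha
    (hF.continuousOn.mono Icc_subset_Ici_self)
    (fun _ ht => hasDerivWithinAt_Ici_of_isIntegralCurveOn hF ht.1)
    (fun _ _ h => h ▸ hga) (right_mem_Icc.2 hx)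

theorem lt_one_of_isIntegralCurveOn_Ici_zero {C : ℝ}
    (hF : IsIntegralCurveOn F (fun _ => g) (Ici 0)) (hF₀ : F 0 = 0)
    (hle : ∀ u ∈ Ico (0 : ℝ) 1, g u ≤ C * (1 - u)) {x : ℝ} (hx : 0 ≤ x) : F x < 1 := by
  -- A rate strictly above `C` makes the barrier `1 - exp (-K t)` outrun `F` wherever they meet.
  obtain ⟨K, hCK, hK⟩ : ∃ K, C < K ∧ 0 ≤ K :=
    ⟨max C 0 + 1, (le_max_left C 0).trans_lt (lt_add_one _),
      add_nonneg (le_max_right C 0) zero_le_one⟩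
  have hbarrier (t : ℝ) : HasDerivAt (fun t => 1 - exp (-(K * t))) (K * exp (-(K * t))) t := by
    refine (((hasDerivAt_id t).const_mul K).neg.exp.const_sub 1).congr_deriv ?_
    simp only [id, Pi.neg_apply]
    ring
  have hF_le : F x ≤ 1 - exp (-(K * x)) := by
    refine image_le_of_deriv_right_lt_deriv_boundary (hF.continuousOn.mono Icc_subset_Ici_self)
      (fun t ht => hasDerivWithinAt_Ici_of_isIntegralCurveOn hF ht.1) (by simp [hF₀]) hbarrier
      (fun t ht hmeet => ?_) (right_mem_Icc.2 hx)
    calc g (F t) ≤ C * (1 - F t) :=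
          hle _ (hmeet ▸ one_sub_exp_neg_mem_Ico (mul_nonneg hK ht.1))
      _ = C * exp (-(K * t)) := by rw [hmeet, sub_sub_cancel]
      _ < K * exp (-(K * t)) := mul_lt_mul_of_pos_right hCK (exp_pos _)
  exact hF_le.trans_lt (sub_lt_self _ (exp_pos _))

end Barriers

section ConvexField

variable {g F : ℝ → ℝ}

theorem le_map_zero_mul_one_sub_of_convexOn (hg : ConvexOn ℝ (Icc 0 1) g) (hg₁ : g 1 = 0) :
    ∀ u ∈ Ico (0 : ℝ) 1, g u ≤ g 0 * (1 - u) := by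
  intro u hu
  have h := hg.2 (left_mem_Icc.2 zero_le_one) (right_mem_Icc.2 zero_le_one)
    (sub_nonneg.2 hu.2.le) hu.1 (sub_add_cancel 1 u)
  simpa only [smul_eq_mul, mul_zero, mul_one, zero_add, hg₁, add_zero, mul_comm (g 0)] using h

theorem one_sub_mul_one_sub_le_of_convexOn (hg : ConvexOn ℝ (Icc 0 1) g) (hg₁ : g 1 = 0)
    (hpos : ∀ u ∈ Ico (0 : ℝ) 1, 0 < g u) (hF₀ : F 0 = 0)
    (hF : IsIntegralCurveOn F (fun _ => g) (Ici 0)) {x y : ℝ} (hx : 0 ≤ x) (hy : 0 ≤ y) :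
    (1 - F x) * (1 - F y) ≤ 1 - F (x + y) := by
  have hF_nonneg : ∀ t ∈ Ici (0 : ℝ), 0 ≤ F t := fun t ht =>
    le_of_isIntegralCurveOn_Ici hF hF₀.ge (hpos 0 (left_mem_Ico.2 one_pos)) ht
  have hF_lt : ∀ t ∈ Ici (0 : ℝ), F t < 1 := fun t ht =>
    lt_one_of_isIntegralCurveOn_Ici_zero hF hF₀ (le_map_zero_mul_one_sub_of_convexOn hg hg₁) ht
  have hsub_pos {t : ℝ} (ht : 0 ≤ t) : 0 < 1 - F t := sub_pos.2 (hF_lt t ht)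
  have hconcave : ConcaveOn ℝ (Ici 0) fun t => -log (1 - F t) :=
    concaveOn_of_isIntegralCurveOn_antitoneOn (convex_Ici 0)
      (isIntegralCurveOn_neg_log_one_sub hF hF_lt)
      (fun t ht => neg_nonneg.2 (log_nonpos (hsub_pos ht).le (sub_le_self _ (hF_nonneg t ht))))
      (antitoneOn_logField hg hg₁) fun _ hv => (logField_pos hpos hv).le
  have hsubadd : -log (1 - F (x + y)) ≤ -log (1 - F x) + -log (1 - F y) :=
    map_add_le_of_concaveOn_Ici hconcave (by simp [hF₀]) hx hy
  rw [← neg_add, neg_le_neg_iff, ← log_mul (hsub_pos hx).ne' (hsub_pos hy).ne'] at hsubadd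
  exact (log_le_log_iff (mul_pos (hsub_pos hx) (hsub_pos hy)) (hsub_pos (add_nonneg hx hy))).1
    hsubadd

theorem corollary4p3_general (hg : ConvexOn ℝ (Icc 0 1) g) (hcont : ContinuousOn g (Ico 0 1))
    (hpos : ∀ u ∈ Ico (0 : ℝ) 1, 0 < g u) (hg₁ : g 1 = 0) :
    (∃ F : ℝ → ℝ, F 0 = 0 ∧ IsIntegralCurveOn F (fun _ => g) (Ici 0)) ∧
      ∀ F : ℝ → ℝ, F 0 = 0 → IsIntegralCurveOn F (fun _ => g) (Ici 0) →
        ∀ x y : ℝ, 0 ≤ x → 0 ≤ y → (1 - F x) * (1 - F y) ≤ 1 - F (x + y) :=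
  ⟨exists_isIntegralCurveOn_Ici_zero hcont hpos (le_map_zero_mul_one_sub_of_convexOn hg hg₁),
    fun _ hF₀ hF _ _ => one_sub_mul_one_sub_le_of_convexOn hg hg₁ hpos hF₀ hF⟩

end ConvexField

section PowerField

variable {α : ℝ}

theorem isProfileFunction_iff {F : ℝ → ℝ} :
    IsProfileFunction α F ↔ F 0 = 0 ∧ IsIntegralCurveOn F (fun _ u => 1 - u ^ α) (Ici 0) :=
  ⟨fun h => ⟨h.map_zero, h.hasDerivWithinAt⟩, fun h => ⟨h.1, h.2⟩⟩

theorem convexOn_one_sub_rpow (hα₀ : 0 ≤ α) (hα₁ : α ≤ 1) :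
    ConvexOn ℝ (Ici 0) fun u : ℝ => 1 - u ^ α :=
  (convexOn_const 1 (convex_Ici 0)).sub (concaveOn_rpow hα₀ hα₁)

theorem one_sub_rpow_pos (hα₀ : 0 < α) : ∀ u ∈ Ico (0 : ℝ) 1, 0 < 1 - u ^ α :=
  fun _ hu => sub_pos.2 (rpow_lt_one hu.1 hu.2 hα₀)

end PowerField

theorem corollary4p3 (α : ℝ) (hα₀ : 0 < α) (hα₁ : α ≤ 1) :
    (∃ F : ℝ → ℝ, IsProfileFunction α F) ∧
      ∀ F : ℝ → ℝ, IsProfileFunction α F →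
        ∀ x y : ℝ, 0 ≤ x → 0 ≤ y → (1 - F x) * (1 - F y) ≤ 1 - F (x + y) := by
  simpa only [isProfileFunction_iff, and_imp] using corollary4p3_general
    ((convexOn_one_sub_rpow hα₀.le hα₁).subset Icc_subset_Ici_self (convex_Icc 0 1))
    (continuous_const.sub (continuous_rpow_const hα₀.le)).continuousOn (one_sub_rpow_pos hα₀)
    (by rw [one_rpow, sub_self])
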